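/- Let $K$ be a field and $A$ a finite-dimensional associative unital $K$-algebra; modules are finite-dimensional left $A$-modules. Let $\{L(\lambda)\mid\lambda\in\Lambda^+\}$ be a complete set of representatives of the isomorphism classes of simple $A$-modules, and assume that $A$ is split over $K$, i.e. $\mathrm{End}_A(L(\lambda))=K$ for all $\lambda\in\Lambda^+$. Let $P(\lambda)$ and $I(\lambda)$ be the projective cover and the injective hull of $L(\lambda)$. Let $\preceq$ be a preorder on $\Lambda^+$, and write $\mu\succ\lambda$ if $\lambda\preceq\mu$ and $\mu\not\preceq\lambda$. For modules $M,N$ let $\mathrm{Tr}_M(N)$ be the sum of the images of all $A$-homomorphisms $M\to N$. Define the standard module $$\Delta(\lambda)=P(\lambda)/\mathrm{Tr}_{P^{\succ\lambda}}(P(\lambda)),\qquad P^{\succ\lambda}=\bigoplus_{\mu\succ\lambda}P(\mu),$$ and the proper costandard module $\overline\nabla(\lambda)\subseteq I(\lambda)$ as the preimage, under $I(\lambda)\to I(\lambda)/\mathrm{soc}\,I(\lambda)$, of the intersection of the kernels of all $A$-homomorphisms $I(\lambda)/\mathrm{soc}\,I(\lambda)\to\bigoplus_{\mu\succeq\lambda}I(\mu)$.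 Assume that $A$ is standardly stratified in the sense of Cline–Parshall–Scott with respect to $\preceq$, i.e. for every $\lambda\in\Lambda^+$: 1. the kernel of the canonical surjection $P(\lambda)\to\Delta(\lambda)$ has a finite filtration with subquotients isomorphic to modules $\Delta(\mu)$ with $\mu\succ\lambda$; 2. the kernel of the canonical surjection $\Delta(\lambda)\to L(\lambda)$ has a finite filtration with subquotients isomorphic to modules $L(\mu)$ with $\mu\preceq\lambda$. Let $T$ be a tilting module, i.e. a finite-dimensional $A$-module which has a finite filtration with all subquotients isomorphic to standard modules $\Delta(\lambda)$ and also a finite filtration with all subquotients isomorphic to proper costandard modules $\overline\nabla(\lambda)$, $\lambda\in\Lambda^+$. Suppose that there is an integer $r\ge 0$ such that for every $\lambda\in\Lambda^+$ there are an injective $A$-homomorphism $\Delta(\lambda)\hookrightarrow T^{\oplus r}$ and a surjective $A$-homomorphism $T^{\oplus r}\twoheadrightarrow\overline\nabla(\lambda)$. Then $T$ is a faithful $A$-module, and $A$ has the double centraliser property with respect to $T$, i.e. the canonical map $A\to\mathrm{End}_{\mathrm{End}_A(T)}(T)$, $a\mapsto(t\mapsto at)$, is surjective. Hence this map is an isomorphism,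 $A=\mathrm{End}_{\mathrm{End}_A(T)}(T)$. -/

import Mathlib

open scoped DirectSum

universe u v w x

namespace StdStrat

/-- `L` is a complete set of representatives of the isomorphism classes of simple left
`A`-modules. -/
structure IsCompleteSimpleFamily (A : Type u) [Ring A] {Λ : Type w} (L : Λ → Type u)
    [∀ l, AddCommGroup (L l)] [∀ l, Module A (L l)] : Prop where
  simple : ∀ l, IsSimpleModule A (L l)
  eq_of_equiv : ∀ l m, Nonempty (L l ≃ₗ[A] L m) → l = m
  exists_equiv : ∀ (S : Type u) [AddCommGroup S] [Module A S], IsSimpleModule A S →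
    ∃ l, Nonempty (S ≃ₗ[A] L l)

/-- `End_A(L l) = K` for every `l`: each `A`-endomorphism of `L l` is multiplication by a scalar
of `K`. -/
def IsSplitOver (K : Type v) [Field K] (A : Type u) [Ring A] [Algebra K A] {Λ : Type w}
    (L : Λ → Type u) [∀ l, AddCommGroup (L l)] [∀ l, Module A (L l)] : Prop :=
  ∀ l, ∀ f : L l →ₗ[A] L l, ∃ c : K, ∀ y, f y = algebraMap K A c • y

/-- `p : P → M` is a projective cover: `P` is projective and `p` is an epimorphism with
superfluous kernel. -/
structure IsProjectiveCover {A : Type u} [Ring A] {P M : Type u} [AddCommGroup P] [Module A P]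
    [AddCommGroup M] [Module A M] (p : P →ₗ[A] M) : Prop where
  projective : Module.Projective A P
  surjective : Function.Surjective p
  superfluous : ∀ N : Submodule A P, N ⊔ LinearMap.ker p = ⊤ → N = ⊤

/-- `i : M → I` is an injective hull: `I` is injective and `i` is an essential monomorphism. -/
structure IsInjectiveHull {A : Type u} [Ring A] {M I : Type u} [AddCommGroup M] [Module A M]
    [AddCommGroup I] [Module A I] (i : M →ₗ[A] I) : Prop where
  injective_module : Module.Injective A I
  injective : Function.Injective i
  essential : ∀ N : Submodule A I, N ⊓ LinearMap.range i = ⊥ → N = ⊥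

/-- The trace of `M` in `N`: the sum of the images of all homomorphisms `M → N`. -/
def trace (A : Type u) [Ring A] (M : Type v) (N : Type w) [AddCommGroup M] [Module A M]
    [AddCommGroup N] [Module A N] : Submodule A N :=
  ⨆ f : M →ₗ[A] N, LinearMap.range f

/-- The socle: the sum of all simple submodules. -/
def socle (A : Type u) [Ring A] (M : Type v) [AddCommGroup M] [Module A M] : Submodule A M :=
  sSup {N : Submodule A M | IsSimpleModule A N}

/-- `M` has a finite filtration `0 = F 0 ⊆ F 1 ⊆ ⋯ ⊆ F n = M` each of whose subquotients
`F (k + 1) / F k` is isomorphic to `X m` for some index `m ∈ S`. -/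
def HasFiltration (A : Type u) [Ring A] {Λ : Type w} (X : Λ → Type v)
    [∀ l, AddCommGroup (X l)] [∀ l, Module A (X l)] (S : Set Λ)
    (M : Type x) [AddCommGroup M] [Module A M] : Prop :=
  ∃ (n : ℕ) (F : ℕ → Submodule A M), F 0 = ⊥ ∧ F n = ⊤ ∧ Monotone F ∧
    ∀ k < n, ∃ m ∈ S,
      Nonempty ((F (k + 1) ⧸ (F k).submoduleOf (F (k + 1))) ≃ₗ[A] X m)

/-- The trace of `⨁_{m ≻ l} P m` in `P l`, where `m ≻ l` means `l ≤ m` and not `m ≤ l`. -/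
def standardKernel (A : Type u) [Ring A] {Λ : Type w} [Preorder Λ] (P : Λ → Type u)
    [∀ l, AddCommGroup (P l)] [∀ l, Module A (P l)] (l : Λ) : Submodule A (P l) :=
  trace A (⨁ m : {m : Λ // l < m}, P m) (P l)

/-- The standard module `Δ(l) = P(l) / Tr(P(l))`, the trace being that of `⨁_{m ≻ l} P m`. -/
abbrev Standard (A : Type u) [Ring A] {Λ : Type w} [Preorder Λ] (P : Λ → Type u)
    [∀ l, AddCommGroup (P l)] [∀ l, Module A (P l)] (l : Λ) : Type u :=
  P l ⧸ standardKernel A P l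

/-- The proper costandard module: the preimage in `I l` of the intersection of the kernels of all
homomorphisms `I l / soc (I l) → ⨁_{m ≽ l} I m`. -/
def properCostandard (A : Type u) [Ring A] {Λ : Type w} [Preorder Λ] (I : Λ → Type u)
    [∀ l, AddCommGroup (I l)] [∀ l, Module A (I l)] (l : Λ) : Submodule A (I l) :=
  (⨅ f : (I l ⧸ socle A (I l)) →ₗ[A] (⨁ m : {m : Λ // l ≤ m}, I m), LinearMap.ker f).comap
    (socle A (I l)).mkQ

/-- Standardly stratified algebras in the sense of Cline, Parshall and Scott, with respect to the
given preorder: the kernel of the canonical surjection `P(l) → Δ(l)` is filtered by `Δ(m)` with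
`m ≻ l`, and the kernel of the canonical surjection `q : Δ(l) → L(l)`, i.e. the map through which
`p l : P(l) → L(l)` factors, is filtered by `L(m)` with `m ≼ l`. -/
def IsStandardlyStratified (A : Type u) [Ring A] {Λ : Type w} [Preorder Λ] {L P : Λ → Type u}
    [∀ l, AddCommGroup (L l)] [∀ l, Module A (L l)]
    [∀ l, AddCommGroup (P l)] [∀ l, Module A (P l)] (p : ∀ l, P l →ₗ[A] L l) : Prop :=
  ∀ l,
    HasFiltration A (Standard A P) {m | l < m} (LinearMap.ker (standardKernel A P l).mkQ) ∧
    ∃ q : Standard A P l →ₗ[A] L l, q ∘ₗ (standardKernel A P l).mkQ = p l ∧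
      HasFiltration A L {m | m ≤ l} (LinearMap.ker q)

/-- Tilting modules: finite dimensional modules that have both a filtration by standard modules
and a filtration by proper costandard modules. -/
structure IsTilting (A : Type u) [Ring A] {Λ : Type w} [Preorder Λ] (P I : Λ → Type u)
    [∀ l, AddCommGroup (P l)] [∀ l, Module A (P l)]
    [∀ l, AddCommGroup (I l)] [∀ l, Module A (I l)]
    (T : Type u) [AddCommGroup T] [Module A T] : Prop where
  finite : Module.Finite A T
  standard_filtration : HasFiltration A (Standard A P) Set.univ T
  properCostandard_filtration :
    HasFiltration A (fun l => properCostandard A I l) Set.univ T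

/-- The canonical map `A → End_{End_A(T)}(T)`, `a ↦ (t ↦ a t)`. -/
def canonicalMap (A : Type u) [Ring A] (T : Type v) [AddCommGroup T] [Module A T] :
    A →+* Module.End (Module.End A T) T :=
  Module.toModuleEnd (Module.End A T) T

/-- The double centraliser property: the canonical map `A → End_{End_A(T)}(T)` is surjective. -/
def HasDoubleCentraliser (A : Type u) [Ring A] (T : Type v) [AddCommGroup T] [Module A T] : Prop :=
  Function.Surjective (canonicalMap A T)

end StdStrat

/-! Choose $t_1,\dots,t_n$ generating $T$ over $E=\mathrm{End}_A(T)$ and let $\varphi\colon A\to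
T^n$, $a\mapsto(at_j)_j$. If $\varphi$ is injective, $T$ is faithful. If $T$ cogenerates
$\mathrm{coker}\,\varphi$, the double centraliser property follows: for
$\alpha\in\mathrm{End}_E(T)$, any map $T^n\to T$ killing $t$ also kills $(\alpha(t_j))_j$, which
therefore equals $(at_j)_j$ for some $a$ (`hasDoubleCentraliser_of_cokernel`).

Both conditions come from `Filtered.cokernel`: a map between $\Delta$-filtered modules along which
all maps to the $\overline\nabla(l)$ extend is injective with $\Delta$-filtered cokernel. It applies
to $\varphi$ because $A$ and $T^n$ are $\Delta$-filtered, and because each $\overline\nabla(l)$ is a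
quotient of $T^r$, all of whose elements are reached from $t$ by endomorphisms. Finally $T$
cogenerates every $\Delta$-filtered module, since $\Delta(l)\hookrightarrow T^r$ and
$\mathrm{Ext}^1(\Delta(l),T)=0$ (`Filtered.exists_hom_ne_zero`).

The homological input is $\mathrm{Ext}^1(\Delta(l),\overline\nabla(m))=0$ for all $l,m$,
$\mathrm{Hom}(\Delta(l),\overline\nabla(m))=0$ for $l\ne m$, and
$\mathrm{Ext}^1(\Delta(l),\Delta(m))=0$ unless $m\succ l$. -/

namespace StdStrat

/-! ### Filtered modules: extensions, kernels, and vanishing of homomorphisms. -/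

section Filtered

variable {A : Type u} [Ring A]

/-- A module is filtered by the `X l`, `l ∈ S`, if it is zero or it has a quotient isomorphic to
some `X l` with `l ∈ S` whose kernel is again filtered. -/
inductive Filtered (A : Type u) [Ring A] {Λ : Type w} (X : Λ → Type u)
    [∀ l, AddCommGroup (X l)] [∀ l, Module A (X l)] (S : Set Λ) :
    ∀ (M : Type u) [AddCommGroup M] [Module A M], Prop
  | zero (M : Type u) [AddCommGroup M] [Module A M] (hM : Subsingleton M) : Filtered A X S M
  | step (M : Type u) [AddCommGroup M] [Module A M] (l : Λ) (hl : l ∈ S) (f : M →ₗ[A] X l)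
      (hf : Function.Surjective f) (h : Filtered A X S (LinearMap.ker f)) : Filtered A X S M

variable {Λ : Type w} {X : Λ → Type u} [∀ l, AddCommGroup (X l)] [∀ l, Module A (X l)]
  {S : Set Λ} {M N Q : Type u} [AddCommGroup M] [Module A M] [AddCommGroup N] [Module A N]
  [AddCommGroup Q] [Module A Q]

/-- The isomorphism between the kernels of two maps that correspond under an isomorphism. -/
theorem nonempty_equiv_ker (e : M ≃ₗ[A] N) (f : M →ₗ[A] Q) (g : N →ₗ[A] Q)
    (h : ∀ x, g (e x) = f x) : Nonempty (LinearMap.ker f ≃ₗ[A] LinearMap.ker g) := by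
  refine ⟨e.ofSubmodules _ _ ?_⟩
  ext y
  simp only [Submodule.mem_map, LinearMap.mem_ker]
  constructor
  · rintro ⟨x, hx, rfl⟩
    simpa [h] using hx
  · intro hy
    exact ⟨e.symm y, by rw [← h]; simpa using hy, by simp⟩

theorem Filtered.of_equiv (hM : Filtered A X S M) (e : M ≃ₗ[A] N) : Filtered A X S N := by
  induction hM generalizing N with
  | zero M h => exact .zero N e.symm.injective.subsingleton
  | step M l hl f hf h ih =>
    obtain ⟨e'⟩ := nonempty_equiv_ker e f (f ∘ₗ e.symm.toLinearMap) (by simp)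
    exact .step N l hl (f ∘ₗ e.symm.toLinearMap) (hf.comp e.symm.surjective) (ih e')

theorem Filtered.of_mem {l : Λ} (hl : l ∈ S) : Filtered A X S (X l) :=
  .step (X l) l hl LinearMap.id Function.surjective_id
    (.zero _ (by rw [LinearMap.ker_id]; infer_instance))

theorem Filtered.mono {S' : Set Λ} (hSS : S ⊆ S') (hM : Filtered A X S M) :
    Filtered A X S' M := by
  induction hM with
  | zero M h => exact .zero M h
  | step M l hl f hf h ih => exact .step M l (hSS hl) f hf ih

/-- Filtered modules are closed under extensions. -/
theorem Filtered.extension (g : M →ₗ[A] N) (hg : Function.Surjective g)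
    (hk : Filtered A X S (LinearMap.ker g)) (hN : Filtered A X S N) : Filtered A X S M := by
  induction hN generalizing M with
  | zero N h =>
    have : LinearMap.ker g = ⊤ := by
      ext x
      simpa using Subsingleton.elim _ _
    rw [this] at hk
    exact hk.of_equiv Submodule.topEquiv
  | step N l hl f hf h ih =>
    -- The top factor of $N$ is also one of $M$; what remains is an extension of $\ker f$ by $\ker
    -- g$.
    refine .step M l hl (f ∘ₗ g) (hf.comp hg) ?_
    let g' : LinearMap.ker (f ∘ₗ g) →ₗ[A] LinearMap.ker f := g.restrict fun x hx => hx
    refine ih g' ?_ (hk.of_equiv ?_)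
    · rintro ⟨y, hy⟩
      obtain ⟨x, rfl⟩ := hg y
      exact ⟨⟨x, hy⟩, rfl⟩
    · refine LinearEquiv.ofBijective
        (LinearMap.codRestrict (LinearMap.ker g')
          (LinearMap.codRestrict (LinearMap.ker (f ∘ₗ g)) (LinearMap.ker g).subtype ?_) ?_)
        ⟨?_, ?_⟩
      · rintro ⟨x, hx⟩
        rw [LinearMap.mem_ker] at hx
        simp [hx]
      · rintro ⟨x, hx⟩
        exact Subtype.ext hx
      · intro x y hxy
        exact Subtype.ext (congrArg (fun z => z.1.1) hxy)
      · rintro ⟨⟨x, hx⟩, hx'⟩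
        exact ⟨⟨x, congrArg Subtype.val hx'⟩, rfl⟩

/-- If `g` extends a surjection `g'` on the kernel of `f : M ↠ N`, then the kernel of `g` is an
extension of `N` by the kernel of `g'`. -/
theorem Filtered.ker_of_extends (f : M →ₗ[A] N) (hf : Function.Surjective f)
    (g : M →ₗ[A] Q) (g' : LinearMap.ker f →ₗ[A] Q) (hg' : Function.Surjective g')
    (h : ∀ x : LinearMap.ker f, g x = g' x) (hN : Filtered A X S N) (hk : Filtered A X S (LinearMap.ker g')) :
    Filtered A X S (LinearMap.ker g) := by
  refine .extension (f ∘ₗ (LinearMap.ker g).subtype) ?_ (hk.of_equiv ?_) hN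
  · intro y
    obtain ⟨x, rfl⟩ := hf y
    -- Subtracting $z\in\ker f$ moves the lift $x$ into $\ker g$ without changing its image in $N$.
    obtain ⟨z, hz⟩ := hg' (g x)
    exact ⟨⟨x - z, by simp [h, hz]⟩, by simp⟩
  · refine LinearEquiv.ofBijective
      (LinearMap.codRestrict (LinearMap.ker (f ∘ₗ (LinearMap.ker g).subtype))
        (LinearMap.codRestrict (LinearMap.ker g)
          ((LinearMap.ker f).subtype ∘ₗ (LinearMap.ker g').subtype) ?_) ?_) ⟨?_, ?_⟩
    · rintro ⟨x, hx⟩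
      simpa [h] using hx
    · rintro ⟨⟨x, hx⟩, hx'⟩
      exact hx
    · intro x y hxy
      exact Subtype.ext (Subtype.ext (congrArg (fun z => z.1.1) hxy))
    · rintro ⟨⟨x, hx⟩, hx'⟩
      refine ⟨⟨⟨x, hx'⟩, ?_⟩, rfl⟩
      rw [LinearMap.mem_ker, ← h]
      exact hx

theorem Filtered.prod (hM : Filtered A X S M) (hN : Filtered A X S N) :
    Filtered A X S (M × N) := by
  refine .extension (LinearMap.snd A M N) Prod.snd_surjective ?_ hN
  rw [← LinearMap.range_inl]
  exact hM.of_equiv (LinearEquiv.ofInjective _ LinearMap.inl_injective)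

theorem Filtered.pi_fin (hM : Filtered A X S M) (n : ℕ) : Filtered A X S (Fin n → M) := by
  induction n with
  | zero => exact .zero _ inferInstance
  | succ n ih => exact (hM.prod ih).of_equiv (Fin.consLinearEquiv A fun _ : Fin (n + 1) => M)

theorem filtered_of_hasFiltration (h : HasFiltration A X S M) : Filtered A X S M := by
  obtain ⟨n, F, h0, hn, hmono, hF⟩ := h
  have key : ∀ k ≤ n, Filtered A X S (F k) := by
    intro k
    induction k with
    | zero =>
      intro _
      rw [h0]
      exact .zero _ inferInstance
    | succ k ih =>
      intro hk
      obtain ⟨l, hl, ⟨e⟩⟩ := hF k hk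
      refine .step _ l hl (e.toLinearMap ∘ₗ ((F k).submoduleOf (F (k + 1))).mkQ)
        (e.surjective.comp (Submodule.mkQ_surjective _)) ?_
      rw [LinearEquiv.ker_comp, Submodule.ker_mkQ]
      exact (ih (by lia)).of_equiv
        (Submodule.submoduleOfEquivOfLe (hmono k.le_succ)).symm
  have := key n le_rfl
  rw [hn] at this
  exact this.of_equiv Submodule.topEquiv

theorem Filtered.hom_to_eq_zero (hM : Filtered A X S M)
    (h : ∀ l ∈ S, ∀ f : N →ₗ[A] X l, f = 0) (f : N →ₗ[A] M) : f = 0 := by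
  induction hM with
  | zero M h => exact LinearMap.ext fun x => Subsingleton.elim _ _
  | step M l hl g hg h' ih =>
    have h0 : g ∘ₗ f = 0 := h l hl _
    have := ih (f.codRestrict (LinearMap.ker g) fun x => LinearMap.congr_fun h0 x)
    ext x
    exact congrArg Subtype.val (LinearMap.congr_fun this x)

/-- A map that vanishes on the kernel of a surjection factors through it. -/
theorem exists_factor {M N Q : Type*} [AddCommGroup M] [Module A M] [AddCommGroup N] [Module A N]
    [AddCommGroup Q] [Module A Q]
    (f : M →ₗ[A] N) (hf : Function.Surjective f) (g : M →ₗ[A] Q)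
    (h : ∀ x, f x = 0 → g x = 0) : ∃ k : N →ₗ[A] Q, ∀ x, k (f x) = g x := by
  refine ⟨(LinearMap.ker f).liftQ g h ∘ₗ (f.quotKerEquivOfSurjective hf).symm.toLinearMap,
    fun x => ?_⟩
  have : (f.quotKerEquivOfSurjective hf).symm (f x) = (LinearMap.ker f).mkQ x := by
    rw [LinearEquiv.symm_apply_eq]
    rfl
  rw [LinearMap.comp_apply, LinearEquiv.coe_coe, this]
  rfl

theorem Filtered.hom_from_eq_zero {N : Type*} [AddCommGroup N] [Module A N]
    (hM : Filtered A X S M)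
    (h : ∀ l ∈ S, ∀ f : X l →ₗ[A] N, f = 0) (f : M →ₗ[A] N) : f = 0 := by
  induction hM with
  | zero M h =>
    ext x
    rw [Subsingleton.elim x 0, map_zero, map_zero]
  | step M l hl g hg h' ih =>
    have h0 := ih (f ∘ₗ (LinearMap.ker g).subtype)
    obtain ⟨k, hk⟩ := exists_factor g hg f fun x hx => LinearMap.congr_fun h0 ⟨x, hx⟩
    ext x
    rw [← hk, h l hl k]
    rfl

end Filtered

/-! ### Vanishing of $\mathrm{Ext}^1$, expressed by extending homomorphisms. -/

section ExtZero

variable {A : Type u} [Ring A] {M N Q : Type u} [AddCommGroup M] [Module A M] [AddCommGroup N]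
  [Module A N] [AddCommGroup Q] [Module A Q]

/-- The vanishing of `Ext¹(M, N)`: homomorphisms to `N` extend from the kernel of every surjection
`Y ↠ M` to `Y`. -/
def ExtZero (A : Type u) [Ring A] (M N : Type u) [AddCommGroup M] [Module A M] [AddCommGroup N]
    [Module A N] : Prop :=
  ∀ (Y : Type u) [AddCommGroup Y] [Module A Y] (f : Y →ₗ[A] M), Function.Surjective f →
    ∀ h : LinearMap.ker f →ₗ[A] N, ∃ k : Y →ₗ[A] N, ∀ y : LinearMap.ker f, k y = h y

/-- One projective presentation suffices: $Q$ maps to any $Y\twoheadrightarrow M$ over $M$, and $Y$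
is the pushout of $Q$ and $\ker f$ along $\ker\pi$. -/
theorem ExtZero.of_projective [Module.Projective A Q] (π : Q →ₗ[A] M)
    (hπ : Function.Surjective π)
    (H : ∀ h : LinearMap.ker π →ₗ[A] N, ∃ k : Q →ₗ[A] N, ∀ y : LinearMap.ker π, k y = h y) : ExtZero A M N := by
  intro Y _ _ f hf h
  obtain ⟨α, hα⟩ := Module.projective_lifting_property f π hf
  have hα' : ∀ q, f (α q) = π q := LinearMap.congr_fun hα
  obtain ⟨ψ, hψ⟩ := H (h ∘ₗ α.restrict fun q hq => by
    rw [LinearMap.mem_ker] at hq ⊢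
    rw [hα', hq])
  obtain ⟨k, hk⟩ := exists_factor (α.coprod (LinearMap.ker f).subtype)
    (fun y => by
      obtain ⟨q, hq⟩ := hπ (f y)
      exact ⟨(q, ⟨y - α q, by simp [hα', hq]⟩), by simp⟩)
    (ψ.coprod h) (by
      rintro ⟨q, y⟩ hqy
      simp only [LinearMap.coprod_apply, Submodule.subtype_apply] at hqy ⊢
      have hq : q ∈ LinearMap.ker π := by
        rw [LinearMap.mem_ker, ← hα']
        simpa using congrArg f hqy
      rw [hψ ⟨q, hq⟩, LinearMap.comp_apply, ← map_add]
      convert map_zero h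
      exact Subtype.ext hqy)
  exact ⟨k, fun y => by simpa using hk (0, y)⟩

theorem ExtZero.of_subsingleton [Subsingleton N] : ExtZero A M N :=
  fun _ _ _ _ _ _ => ⟨0, fun _ => Subsingleton.elim _ _⟩

/-- Tested on the free module on the set $M$: extend $g\circ h$, lift the extension to $N$ by
projectivity, then correct the error, which takes values in $\ker g$. -/
theorem ExtZero.extension (g : N →ₗ[A] Q) (hg : Function.Surjective g)
    (hk : ExtZero A M (LinearMap.ker g)) (hQ : ExtZero A M Q) : ExtZero A M N := by
  have hs : Function.Surjective (Finsupp.linearCombination A (id : M → M)) :=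
    Finsupp.linearCombination_id_surjective A M
  refine .of_projective _ hs fun h => ?_
  obtain ⟨k, hk'⟩ := hQ _ _ hs (g ∘ₗ h)
  obtain ⟨k', hk''⟩ := Module.projective_lifting_property g k hg
  obtain ⟨m, hm⟩ := hk _ _ hs
    ((h - k' ∘ₗ (LinearMap.ker _).subtype).codRestrict (LinearMap.ker g) fun y => by
      have h1 : g (k' y) = k y := LinearMap.congr_fun hk'' y
      have h2 : k y = g (h y) := hk' y
      simp [h1, h2])
  refine ⟨k' + (LinearMap.ker g).subtype ∘ₗ m, fun y => ?_⟩
  rw [LinearMap.add_apply, LinearMap.comp_apply, hm y]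
  exact add_sub_cancel (k' y) (h y)

theorem Filtered.extZero {Λ : Type w} {X : Λ → Type u} [∀ l, AddCommGroup (X l)]
    [∀ l, Module A (X l)] {S : Set Λ} (hN : Filtered A X S N) (h : ∀ l ∈ S, ExtZero A M (X l)) :
    ExtZero A M N := by
  induction hN with
  | zero N hN => exact .of_subsingleton
  | step N l hl f hf h' ih => exact .extension f hf ih (h l hl)

/-- If `N` embeds into an injective module such that there are no nonzero maps from `M` to the
cokernel, then `Ext¹(M, N) = 0`. -/
theorem ExtZero.of_submodule_injective {I : Type u} [AddCommGroup I] [Module A I]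
    (hI : Module.Injective A I) (N : Submodule A I) (h : ∀ f : M →ₗ[A] I ⧸ N, f = 0) :
    ExtZero A M N := by
  intro Y _ _ f hf k
  obtain ⟨g, hg⟩ := hI.out (LinearMap.ker f).subtype (Submodule.subtype_injective _)
    (N.subtype ∘ₗ k)
  -- The extension $g$ to $I$ takes values in $N$, because modulo $N$ it induces a map $M\to I/N$,
  -- which is zero.
  obtain ⟨m, hm⟩ := exists_factor f hf (N.mkQ ∘ₗ g) fun y hy => by
    have := hg ⟨y, hy⟩
    simp_all
  have hgN : ∀ y, g y ∈ N := fun y => by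
    have := hm y
    rw [h m] at this
    simpa [(Submodule.Quotient.mk_eq_zero N).symm, eq_comm] using this
  exact ⟨g.codRestrict N hgN, fun y => Subtype.ext (hg y)⟩

end ExtZero

/-! ### Projective covers and injective hulls of simple modules. -/

section Covers

variable {A : Type u} [Ring A] {P M I S : Type u} [AddCommGroup P] [Module A P]
    [AddCommGroup M] [Module A M] [AddCommGroup I] [Module A I] [AddCommGroup S] [Module A S]

/-- The kernel of $p$ is maximal and superfluous, hence the largest proper submodule. -/
theorem IsProjectiveCover.le_ker {p : P →ₗ[A] M} (hp : IsProjectiveCover p)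
    (hM : IsSimpleModule A M) {N : Submodule A P} (hN : N ≠ ⊤) : N ≤ LinearMap.ker p := by
  by_contra h
  refine hN (hp.superfluous N ?_)
  exact (LinearMap.isCoatom_ker_of_surjective hp.surjective).2 _ (right_lt_sup.mpr h)

theorem IsProjectiveCover.ker_eq {p : P →ₗ[A] M} (hp : IsProjectiveCover p)
    (hM : IsSimpleModule A M) (hS : IsSimpleModule A S) {f : P →ₗ[A] S} (hf : f ≠ 0) :
    LinearMap.ker f = LinearMap.ker p :=
  (LinearMap.isCoatom_ker_of_surjective (LinearMap.surjective_of_ne_zero hf)).le_iff_eq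
    (LinearMap.isCoatom_ker_of_surjective hp.surjective).1 |>.mp
      (hp.le_ker hM fun h => hf (LinearMap.ker_eq_top.mp h)) |>.symm

theorem IsProjectiveCover.ker_le {p : P →ₗ[A] M} (hp : IsProjectiveCover p)
    (hM : IsSimpleModule A M) (hS : IsSimpleModule A S) (f : P →ₗ[A] S) :
    LinearMap.ker p ≤ LinearMap.ker f := by
  rcases eq_or_ne f 0 with rfl | hf
  · simp
  · exact (hp.ker_eq hM hS hf).ge

theorem IsProjectiveCover.nonempty_equiv {p : P →ₗ[A] M} (hp : IsProjectiveCover p)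
    (hM : IsSimpleModule A M) (hS : IsSimpleModule A S) {f : P →ₗ[A] S} (hf : f ≠ 0) :
    Nonempty (M ≃ₗ[A] S) :=
  ⟨(p.quotKerEquivOfSurjective hp.surjective).symm ≪≫ₗ
    Submodule.quotEquivOfEq _ _ (hp.ker_eq hM hS hf).symm ≪≫ₗ
    f.quotKerEquivOfSurjective (LinearMap.surjective_of_ne_zero hf)⟩

/-- A map to the source of a projective cover is surjective if its composite with the cover is. -/
theorem IsProjectiveCover.surjective_of_comp {p : P →ₗ[A] M} (hp : IsProjectiveCover p)
    (f : S →ₗ[A] P) (hf : Function.Surjective (p ∘ₗ f)) : Function.Surjective f := by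
  rw [← LinearMap.range_eq_top]
  refine hp.superfluous _ (eq_top_iff.mpr fun x _ => ?_)
  obtain ⟨y, hy⟩ := hf (p x)
  rw [Submodule.mem_sup]
  exact ⟨f y, ⟨y, rfl⟩, x - f y, by simpa [sub_eq_zero] using hy.symm, by simp⟩

/-- A surjection $A\to M$ lifts to $A\to P$, which is again surjective. -/
theorem IsProjectiveCover.finite {p : P →ₗ[A] M} (hp : IsProjectiveCover p)
    (hM : IsSimpleModule A M) : Module.Finite A P := by
  have := IsSimpleModule.nontrivial A M
  obtain ⟨m, hm⟩ := exists_ne (0 : M)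
  obtain ⟨f, hf⟩ := Module.projective_lifting_property p (LinearMap.toSpanSingleton A M m)
    hp.surjective
  refine Module.Finite.of_surjective f (hp.surjective_of_comp f ?_)
  rw [hf]
  exact IsSimpleModule.toSpanSingleton_surjective A hm

theorem IsInjectiveHull.range_eq {i : M →ₗ[A] I} (hi : IsInjectiveHull i)
    (hM : IsSimpleModule A M) (N : Submodule A I) (hN : IsSimpleModule A N) :
    N = LinearMap.range i := by
  have hr : IsSimpleModule A (LinearMap.range i) :=
    IsSimpleModule.congr (LinearEquiv.ofInjective i hi.injective).symm
  rw [isSimpleModule_iff_isAtom] at hN hr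
  by_contra h
  exact hN.1 (hi.essential N (hN.disjoint_of_ne hr h).eq_bot)

theorem IsInjectiveHull.socle_eq {i : M →ₗ[A] I} (hi : IsInjectiveHull i)
    (hM : IsSimpleModule A M) : socle A I = LinearMap.range i :=
  le_antisymm (sSup_le fun N hN => (hi.range_eq hM N hN).le)
    (le_sSup (IsSimpleModule.congr (LinearEquiv.ofInjective i hi.injective).symm))

theorem IsInjectiveHull.nonempty_equiv {i : M →ₗ[A] I} (hi : IsInjectiveHull i)
    (hM : IsSimpleModule A M) (hS : IsSimpleModule A S) {f : S →ₗ[A] I} (hf : f ≠ 0) :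
    Nonempty (S ≃ₗ[A] M) := by
  have e := LinearEquiv.ofInjective f (LinearMap.injective_of_ne_zero hf)
  have := hi.range_eq hM _ (IsSimpleModule.congr e.symm)
  exact ⟨e ≪≫ₗ LinearEquiv.ofEq _ _ this ≪≫ₗ (LinearEquiv.ofInjective i hi.injective).symm⟩

end Covers

/-! ### Vanishing of $\mathrm{Hom}$ and $\mathrm{Ext}^1$ between standard and proper costandard
modules. -/

section Vanishing

variable {A : Type u} [Ring A] {Λ : Type w} [Preorder Λ] {L P I : Λ → Type u}
    [∀ l, AddCommGroup (L l)] [∀ l, Module A (L l)]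
    [∀ l, AddCommGroup (P l)] [∀ l, Module A (P l)]
    [∀ l, AddCommGroup (I l)] [∀ l, Module A (I l)]
    {p : ∀ l, P l →ₗ[A] L l} {i : ∀ l, L l →ₗ[A] I l}

theorem IsStandardlyStratified.filtered_standard (hA : IsStandardlyStratified A p)
    (hp : ∀ l, IsProjectiveCover (p l)) (l : Λ) :
    Filtered A L {m | m ≤ l} (Standard A P l) := by
  obtain ⟨q, hq, hF⟩ := (hA l).2
  refine .step _ l le_rfl q ?_ (filtered_of_hasFiltration hF)
  have := (hp l).surjective
  rw [← hq, LinearMap.coe_comp] at this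
  exact this.of_comp

theorem IsStandardlyStratified.filtered_projective (hA : IsStandardlyStratified A p) (l : Λ) :
    Filtered A (Standard A P) Set.univ (P l) :=
  .step _ l trivial (standardKernel A P l).mkQ (Submodule.mkQ_surjective _)
    ((filtered_of_hasFiltration (hA l).1).mono (Set.subset_univ _))

/-- Composition factors $L(k)$ of $\Delta(l)$ have $k\preceq l$, and $I(m)$ receives nonzero maps
only from the simple $L(m)$. -/
theorem hom_standard_injective_eq_zero (hL : IsCompleteSimpleFamily A L)
    (hp : ∀ l, IsProjectiveCover (p l)) (hi : ∀ l, IsInjectiveHull (i l))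
    (hA : IsStandardlyStratified A p) {l m : Λ} (h : ¬ m ≤ l)
    (f : Standard A P l →ₗ[A] I m) : f = 0 := by
  refine (hA.filtered_standard hp l).hom_from_eq_zero (fun k hk g => ?_) f
  by_contra hg
  obtain rfl := hL.eq_of_equiv _ _ ((hi m).nonempty_equiv (hL.simple m) (hL.simple k) hg)
  exact h hk

theorem hom_projective_standard_eq_zero (hL : IsCompleteSimpleFamily A L)
    (hp : ∀ l, IsProjectiveCover (p l)) (hA : IsStandardlyStratified A p) {l m : Λ}
    (h : ¬ l ≤ m) (f : P l →ₗ[A] Standard A P m) : f = 0 := by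
  refine (hA.filtered_standard hp m).hom_to_eq_zero (fun k hk g => ?_) f
  by_contra hg
  obtain rfl := hL.eq_of_equiv _ _ ((hp l).nonempty_equiv (hL.simple l) (hL.simple k) hg)
  exact h hk

theorem hom_standard_standard_eq_zero (hL : IsCompleteSimpleFamily A L)
    (hp : ∀ l, IsProjectiveCover (p l)) (hA : IsStandardlyStratified A p) {l m : Λ}
    (h : ¬ l ≤ m) (f : Standard A P l →ₗ[A] Standard A P m) : f = 0 := by
  have := hom_projective_standard_eq_zero hL hp hA h (f ∘ₗ (standardKernel A P l).mkQ)
  rwa [← LinearMap.zero_comp (standardKernel A P l).mkQ,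
    LinearMap.cancel_right (Submodule.mkQ_surjective _)] at this

/-- The trace is generated by images of the $P(m)$, $m\succ l$. The equation `hB` lets the lemma
apply directly to the kernel of the quotient map. -/
theorem hom_standardKernel_eq_zero {N : Type u} [AddCommGroup N] [Module A N] {l : Λ}
    (h : ∀ m, l < m → ∀ f : P m →ₗ[A] N, f = 0) {B : Submodule A (P l)}
    (hB : B = standardKernel A P l) (f : B →ₗ[A] N) : f = 0 := by
  classical
  suffices B ≤ (LinearMap.ker f).map B.subtype by
    ext x
    obtain ⟨y, hy, hyx⟩ := this x.2
    rw [← Subtype.ext hyx]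
    exact hy
  conv_lhs => rw [hB]
  refine iSup_le fun g => ?_
  have hg : ∀ y, g y ∈ B := fun y => by
    rw [hB]
    exact Submodule.mem_iSup_of_mem g ⟨y, rfl⟩
  have h0 : f ∘ₗ g.codRestrict B hg = 0 :=
    DirectSum.linearMap_ext _ fun m => by
      rw [LinearMap.zero_comp]
      exact h m m.2 _
  rintro _ ⟨y, rfl⟩
  exact ⟨g.codRestrict B hg y, LinearMap.congr_fun h0 y, rfl⟩

theorem extZero_standard (hp : ∀ l, IsProjectiveCover (p l)) {N : Type u} [AddCommGroup N]
    [Module A N] {l : Λ} (h : ∀ m, l < m → ∀ f : P m →ₗ[A] N, f = 0) :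
    ExtZero A (Standard A P l) N := by
  have := (hp l).projective
  refine .of_projective (standardKernel A P l).mkQ (Submodule.mkQ_surjective _) fun f => ⟨0, ?_⟩
  rw [hom_standardKernel_eq_zero h (Submodule.ker_mkQ _) f]
  exact fun _ => rfl

theorem extZero_standard_standard (hL : IsCompleteSimpleFamily A L)
    (hp : ∀ l, IsProjectiveCover (p l)) (hA : IsStandardlyStratified A p) {l m : Λ}
    (h : ¬ l < m) : ExtZero A (Standard A P l) (Standard A P m) :=
  extZero_standard hp fun _ hk =>
    hom_projective_standard_eq_zero hL hp hA fun hkm => h (hk.trans_le hkm)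

theorem mem_properCostandard {m : Λ} {x : I m} : x ∈ properCostandard A I m ↔
    ∀ f : (I m ⧸ socle A (I m)) →ₗ[A] (⨁ k : {k : Λ // m ≤ k}, I k),
      f ((socle A (I m)).mkQ x) = 0 := by
  simp only [properCostandard, Submodule.mem_comap, Submodule.mem_iInf, LinearMap.mem_ker]

/-- Homomorphisms from `P(l)` to a proper costandard module `∇(m)` with `m ≼ l` have their image
in the socle. -/
theorem exists_hom_simple_of_hom_properCostandard (hL : IsCompleteSimpleFamily A L)
    (hp : ∀ l, IsProjectiveCover (p l)) (hi : ∀ l, IsInjectiveHull (i l)) {l m : Λ} (h : m ≤ l)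
    (f : P l →ₗ[A] properCostandard A I m) : ∃ g : P l →ₗ[A] L m, ∀ x, i m (g x) = f x := by
  classical
  have hf : (socle A (I m)).mkQ ∘ₗ (properCostandard A I m).subtype ∘ₗ f = 0 := by
    by_contra h0
    set f' := (socle A (I m)).mkQ ∘ₗ (properCostandard A I m).subtype ∘ₗ f with hf'
    have hk := (hp l).le_ker (hL.simple l) fun h => h0 (LinearMap.ker_eq_top.mp h)
    -- If $f'\ne0$, its image has top $L(l)$; the map from it to $L(l)\subseteq I(l)$ extends to
    -- $I(m)/\mathrm{soc}\,I(m)$, and by definition of $\overline\nabla(m)$ the extension kills the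
    -- image. Then $p_l=0$, a contradiction.
    obtain ⟨k, hk⟩ := exists_factor f'.rangeRestrict f'.surjective_rangeRestrict (p l)
      fun x hx => hk (congrArg Subtype.val hx)
    obtain ⟨e, he⟩ := (hi l).injective_module.out (LinearMap.range f').subtype
      (Submodule.subtype_injective _) (i l ∘ₗ k)
    have hz : ∀ x, p l x = 0 := fun x => by
      have hx := (f x).2
      rw [mem_properCostandard] at hx
      have h1 : DirectSum.lof A {k : Λ // m ≤ k} (fun k => I k) ⟨l, h⟩ (e (f' x)) = 0 :=
        hx (DirectSum.lof A {k : Λ // m ≤ k} (fun k => I k) ⟨l, h⟩ ∘ₗ e)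
      have h2 := congrArg (DirectSum.component A _ _ ⟨l, h⟩) h1
      rw [DirectSum.component.lof_self, map_zero] at h2
      have h3 : e (f' x) = i l (k (f'.rangeRestrict x)) := he (f'.rangeRestrict x)
      rw [hk, h2] at h3
      exact (hi l).injective (by rw [← h3, map_zero])
    have := hL.simple l
    have := IsSimpleModule.nontrivial A (L l)
    obtain ⟨y, hy⟩ := exists_ne (0 : L l)
    obtain ⟨x, rfl⟩ := (hp l).surjective y
    exact hy (hz x)
  have hr : ∀ x, ((properCostandard A I m).subtype ∘ₗ f) x ∈ LinearMap.range (i m) := fun x => by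
    rw [← (hi m).socle_eq (hL.simple m), ← Submodule.Quotient.mk_eq_zero]
    exact LinearMap.congr_fun hf x
  refine ⟨(LinearEquiv.ofInjective (i m) (hi m).injective).symm.toLinearMap ∘ₗ
    LinearMap.codRestrict _ _ hr, fun x => ?_⟩
  exact congrArg Subtype.val ((LinearEquiv.ofInjective (i m) (hi m).injective).apply_symm_apply
    (LinearMap.codRestrict _ _ hr x))

theorem hom_projective_properCostandard_eq_zero (hL : IsCompleteSimpleFamily A L)
    (hp : ∀ l, IsProjectiveCover (p l)) (hi : ∀ l, IsInjectiveHull (i l)) {l m : Λ} (h : m ≤ l)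
    (hlm : l ≠ m) (f : P l →ₗ[A] properCostandard A I m) : f = 0 := by
  obtain ⟨g, hg⟩ := exists_hom_simple_of_hom_properCostandard hL hp hi h f
  have : g = 0 := by
    by_contra h0
    exact hlm (hL.eq_of_equiv _ _ ((hp l).nonempty_equiv (hL.simple l) (hL.simple m) h0))
  ext x
  rw [← hg, this]
  simp

theorem hom_standard_properCostandard_eq_zero (hL : IsCompleteSimpleFamily A L)
    (hp : ∀ l, IsProjectiveCover (p l)) (hi : ∀ l, IsInjectiveHull (i l))
    (hA : IsStandardlyStratified A p) {l m : Λ} (hlm : l ≠ m)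
    (f : Standard A P l →ₗ[A] properCostandard A I m) : f = 0 := by
  by_cases h : m ≤ l
  · have := hom_projective_properCostandard_eq_zero hL hp hi h hlm
      (f ∘ₗ (standardKernel A P l).mkQ)
    rwa [← LinearMap.zero_comp (standardKernel A P l).mkQ,
      LinearMap.cancel_right (Submodule.mkQ_surjective _)] at this
  · have := hom_standard_injective_eq_zero hL hp hi hA h ((properCostandard A I m).subtype ∘ₗ f)
    exact LinearMap.ext fun x => Subtype.ext (LinearMap.congr_fun this x)

/-- By construction $I(m)/\overline\nabla(m)$ is cogenerated by the $I(k)$, $k\succeq m$, none of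
which receives a nonzero map from $\Delta(l)$. -/
theorem hom_standard_quotient_properCostandard_eq_zero (hL : IsCompleteSimpleFamily A L)
    (hp : ∀ l, IsProjectiveCover (p l)) (hi : ∀ l, IsInjectiveHull (i l))
    (hA : IsStandardlyStratified A p) {l m : Λ} (h : ¬ m ≤ l)
    (f : Standard A P l →ₗ[A] I m ⧸ properCostandard A I m) : f = 0 := by
  refine LinearMap.ext fun x => ?_
  obtain ⟨y, hy⟩ := Submodule.mkQ_surjective _ (f x)
  rw [← hy, LinearMap.zero_apply, Submodule.mkQ_apply, Submodule.Quotient.mk_eq_zero,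
    mem_properCostandard]
  intro g
  obtain ⟨g', hg'⟩ := exists_factor (properCostandard A I m).mkQ (Submodule.mkQ_surjective _)
    (g ∘ₗ (socle A (I m)).mkQ) fun z hz => by
      rw [Submodule.mkQ_apply, Submodule.Quotient.mk_eq_zero, mem_properCostandard] at hz
      exact hz g
  refine DirectSum.ext_component A fun k => ?_
  have := hom_standard_injective_eq_zero hL hp hi hA (fun hk => h (k.2.trans hk))
    (DirectSum.component A _ _ k ∘ₗ g' ∘ₗ f)
  have hx := LinearMap.congr_fun this x
  simp only [LinearMap.comp_apply, ← hy] at hx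
  rw [hg'] at hx
  rw [map_zero]
  exact hx

/-- For $m\preceq l$ the projective presentation of $\Delta(l)$ works, since $P(k)$ with $k\succ l$
has no nonzero map to $\overline\nabla(m)$; otherwise the embedding $\overline\nabla(m)\subseteq
I(m)$ does. -/
theorem extZero_standard_properCostandard (hL : IsCompleteSimpleFamily A L)
    (hp : ∀ l, IsProjectiveCover (p l)) (hi : ∀ l, IsInjectiveHull (i l))
    (hA : IsStandardlyStratified A p) (l m : Λ) :
    ExtZero A (Standard A P l) (properCostandard A I m) := by
  by_cases h : m ≤ l
  · exact extZero_standard hp fun k hk => hom_projective_properCostandard_eq_zero hL hp hi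
      (h.trans hk.le) (h.trans_lt hk).ne'
  · exact .of_submodule_injective (hi m).injective_module _
      (hom_standard_quotient_properCostandard_eq_zero hL hp hi hA h)

/-- There is a homomorphism `Δ(l) → ∇(l)` that is not zero. -/
theorem exists_standard_properCostandard_ne_zero (hL : IsCompleteSimpleFamily A L)
    (hp : ∀ l, IsProjectiveCover (p l)) (hi : ∀ l, IsInjectiveHull (i l))
    (hA : IsStandardlyStratified A p) (l : Λ) :
    ∃ f : Standard A P l →ₗ[A] properCostandard A I l, f ≠ 0 := by
  obtain ⟨q, hq, -⟩ := (hA l).2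
  have hs : ∀ x, i l x ∈ properCostandard A I l := fun x => by
    rw [properCostandard, Submodule.mem_comap]
    have : i l x ∈ socle A (I l) := by
      rw [(hi l).socle_eq (hL.simple l)]
      exact ⟨x, rfl⟩
    rw [Submodule.mkQ_apply, (Submodule.Quotient.mk_eq_zero _).mpr this]
    exact zero_mem _
  -- The composite $\Delta(l)\twoheadrightarrow L(l)\hookrightarrow\overline\nabla(l)$.
  refine ⟨(i l).codRestrict _ hs ∘ₗ q, fun h => ?_⟩
  have := hL.simple l
  have := IsSimpleModule.nontrivial A (L l)
  obtain ⟨y, hy⟩ := exists_ne (0 : L l)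
  obtain ⟨x, rfl⟩ := (hp l).surjective y
  refine hy ((hi l).injective ?_)
  rw [← hq, map_zero]
  exact congrArg Subtype.val (LinearMap.congr_fun h ((standardKernel A P l).mkQ x))

/-- An endomorphism of `Δ(l)` is bijective if some map `Δ(l) → ∇(l)` is not zero on its image. -/
theorem bijective_of_hom_properCostandard [IsNoetherianRing A] (hL : IsCompleteSimpleFamily A L)
    (hp : ∀ l, IsProjectiveCover (p l)) (hi : ∀ l, IsInjectiveHull (i l)) {l : Λ}
    (f : Standard A P l →ₗ[A] Standard A P l)
    (h : Standard A P l →ₗ[A] properCostandard A I l) (hf : h ∘ₗ f ≠ 0) :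
    Function.Bijective f := by
  have := (hp l).finite (hL.simple l)
  suffices Function.Surjective f from IsNoetherian.bijective_of_surjective_endomorphism f this
  by_contra hs
  -- The map $h$ factors through a simple module, so it kills the image of $\ker p_l$, which
  -- contains the image of every non-surjective endomorphism.
  obtain ⟨g, hg⟩ := exists_hom_simple_of_hom_properCostandard hL hp hi le_rfl
    (h ∘ₗ (standardKernel A P l).mkQ)
  have hr : (LinearMap.range f).comap (standardKernel A P l).mkQ ≠ ⊤ := fun ht => hs fun y => by
    obtain ⟨x, rfl⟩ := Submodule.mkQ_surjective _ y
    have : x ∈ (LinearMap.range f).comap (standardKernel A P l).mkQ := ht ▸ trivial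
    exact this
  refine hf (LinearMap.ext fun y => ?_)
  obtain ⟨x, hx⟩ := Submodule.mkQ_surjective _ (f y)
  have hx' : p l x = 0 := (hp l).le_ker (hL.simple l) hr
    (show (standardKernel A P l).mkQ x ∈ LinearMap.range f from ⟨y, hx.symm⟩)
  have hgx : g x = 0 := (hp l).ker_le (hL.simple l) (hL.simple l) g hx'
  rw [LinearMap.comp_apply, ← hx]
  apply Subtype.ext
  have := hg x
  rw [hgx, map_zero] at this
  exact this.symm

end Vanishing

/-! ### Rearranging filtrations, cogeneration by $T$, and filtrations of projectives. -/

section Filtered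

variable {A : Type u} [Ring A] {Λ : Type w} {X : Λ → Type u} [∀ l, AddCommGroup (X l)]
  [∀ l, Module A (X l)] {S : Set Λ} {M N Q T : Type u} [AddCommGroup M] [Module A M]
  [AddCommGroup N] [Module A N] [AddCommGroup Q] [Module A Q] [AddCommGroup T] [Module A T]

theorem Filtered.of_exact (f : N →ₗ[A] M) (hf : Function.Injective f) (g : M →ₗ[A] Q)
    (hg : Function.Surjective g) (hfg : ∀ x, g x = 0 ↔ ∃ y, f y = x)
    (hN : Filtered A X S N) (hQ : Filtered A X S Q) : Filtered A X S M := by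
  refine .extension g hg ?_ hQ
  have : LinearMap.ker g = LinearMap.range f := by
    ext x
    exact hfg x
  rw [this]
  exact hN.of_equiv (LinearEquiv.ofInjective f hf)

/-- If `Ext¹(X l, X m) = 0` for all `l ∈ S` and `m ∉ S`, then the subquotients `X l` with `l ∈ S`
can be moved to the bottom of a filtration. -/
theorem Filtered.exists_submodule (hM : Filtered A X Set.univ M)
    (hS : ∀ l ∈ S, ∀ m ∉ S, ExtZero A (X l) (X m)) :
    ∃ B : Submodule A M, Filtered A X S B ∧ Filtered A X Sᶜ (M ⧸ B) := by
  induction hM with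
  | zero M h =>
    exact ⟨⊥, .zero _ inferInstance, .zero _ (Submodule.mkQ_surjective _).subsingleton⟩
  | step M l _ f hf h ih =>
    obtain ⟨B, hB, hQ⟩ := ih
    by_cases hl : l ∈ S
    -- Extending $\ker f\to\ker f/B$ to $M$ splits off $\ker f/B$ as a quotient; the kernel of the
    -- extension is $B$ enlarged by the factor $X_l$.
    · obtain ⟨g, hg⟩ := hQ.extZero (fun m hm => hS l hl m hm) M f hf B.mkQ
      refine ⟨LinearMap.ker g, ?_, hQ.of_equiv ?_⟩
      · refine .ker_of_extends f hf g B.mkQ (Submodule.mkQ_surjective _) hg (.of_mem hl) ?_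
        rwa [Submodule.ker_mkQ]
      · refine (g.quotKerEquivOfSurjective fun z => ?_).symm
        obtain ⟨x, rfl⟩ := Submodule.mkQ_surjective _ z
        exact ⟨x, hg x⟩
    · refine ⟨B.map (LinearMap.ker f).subtype, hB.of_equiv (Submodule.equivSubtypeMap _ B), ?_⟩
      refine .of_exact (B.mapQ _ (LinearMap.ker f).subtype (Submodule.le_comap_map _ _)) ?_
        ((B.map (LinearMap.ker f).subtype).liftQ f ?_) ?_ ?_ hQ (.of_mem hl)
      · rw [← LinearMap.ker_eq_bot, Submodule.mapQ, Submodule.ker_liftQ_eq_bot]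
        intro x hx
        rw [LinearMap.ker_comp, Submodule.ker_mkQ, Submodule.mem_comap] at hx
        obtain ⟨y, hy, hyx⟩ := hx
        rwa [← Subtype.ext hyx]
      · rintro _ ⟨y, -, rfl⟩
        exact y.2
      · exact fun z => (hf z).imp' (Submodule.mkQ _) fun x hx => hx
      · intro z
        obtain ⟨x, rfl⟩ := Submodule.mkQ_surjective _ z
        constructor
        · exact fun hx => ⟨B.mkQ ⟨x, hx⟩, rfl⟩
        · rintro ⟨y, hy⟩
          obtain ⟨y, rfl⟩ := Submodule.mkQ_surjective _ y
          rw [← hy]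
          exact y.2

/-- If the `X l` are cogenerated by `T` and `Ext¹(X l, T) = 0`, then every filtered module is
cogenerated by `T`. -/
theorem Filtered.exists_hom_ne_zero (hM : Filtered A X S M)
    (hT : ∀ l ∈ S, ExtZero A (X l) T)
    (hX : ∀ l ∈ S, ∀ x : X l, x ≠ 0 → ∃ f : X l →ₗ[A] T, f x ≠ 0) (x : M) (hx : x ≠ 0) :
    ∃ f : M →ₗ[A] T, f x ≠ 0 := by
  induction hM with
  | zero M h => exact absurd (Subsingleton.elim _ _) hx
  | step M l hl g hg h ih =>
    -- An element of $\ker g$ is detected there and the map extended by $\mathrm{Ext}^1(X_l,T)=0$;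
    -- any other is detected in $X_l$.
    by_cases hgx : g x = 0
    · obtain ⟨f, hf⟩ := ih ⟨x, hgx⟩ fun h => hx (congrArg Subtype.val h)
      obtain ⟨k, hk⟩ := hT l hl M g hg f
      exact ⟨k, by rwa [← hk] at hf⟩
    · obtain ⟨f, hf⟩ := hX l hl _ hgx
      exact ⟨f ∘ₗ g, hf⟩

/-- If the projective covers of the simple modules are filtered, then so are all finitely generated
projective modules. -/
theorem filtered_of_projective [IsArtinianRing A] {L P : Λ → Type u}
    [∀ l, AddCommGroup (L l)] [∀ l, Module A (L l)]
    [∀ l, AddCommGroup (P l)] [∀ l, Module A (P l)] {p : ∀ l, P l →ₗ[A] L l}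
    (hL : IsCompleteSimpleFamily A L) (hp : ∀ l, IsProjectiveCover (p l))
    (hP : ∀ l, Filtered A X S (P l)) [Module.Finite A M] [Module.Projective A M] :
    Filtered A X S M := by
  suffices ∀ N : Submodule A M, Module.Projective A N → Filtered A X S N from
    (this ⊤ (.of_equiv Submodule.topEquiv.symm)).of_equiv Submodule.topEquiv
  intro N
  induction N using WellFoundedLT.induction with
  | _ N ih =>
  intro hN
  rcases subsingleton_or_nontrivial N with hs | hs
  · exact .zero _ hs
  obtain ⟨C, hC, -⟩ := (eq_top_or_exists_le_coatom (⊥ : Submodule A N)).resolve_left bot_ne_top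
  obtain ⟨l, ⟨e⟩⟩ := hL.exists_equiv (N ⧸ C) (isSimpleModule_iff_isCoatom.mpr hC)
  obtain ⟨g, hg⟩ := Module.projective_lifting_property (p l) (e.toLinearMap ∘ₗ C.mkQ)
    (hp l).surjective
  have hgs : Function.Surjective g := (hp l).surjective_of_comp g (by
    rw [hg]
    exact e.surjective.comp (Submodule.mkQ_surjective _))
  have := (hp l).projective
  -- So $P(l)$ splits off $N$, and the complement $\ker g$ is projective and strictly smaller.
  obtain ⟨s, hs'⟩ := Module.projective_lifting_property g LinearMap.id hgs
  have hgs' : ∀ y, g (s y) = y := LinearMap.congr_fun hs'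
  have hk : Module.Projective A (LinearMap.ker g) :=
    .of_split (LinearMap.ker g).subtype
      ((LinearMap.id - s ∘ₗ g).codRestrict (LinearMap.ker g) fun x => by simp [hgs'])
      (LinearMap.ext fun x => Subtype.ext (by simp))
  refine .extension g hgs ?_ (hP l)
  let e' := Submodule.equivSubtypeMap N (LinearMap.ker g)
  refine (ih _ (lt_of_le_of_ne (Submodule.map_subtype_le _ _) fun h => ?_)
    (.of_equiv e')).of_equiv e'.symm
  have hker : LinearMap.ker g = ⊤ := by
    exact Submodule.map_injective_of_injective N.subtype_injective
      (h.trans (Submodule.map_subtype_top N).symm)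
  have hz : ∀ y, (p l) y = 0 := fun y => by
    rw [← hgs' y, LinearMap.mem_ker.mp (hker ▸ Submodule.mem_top : s y ∈ LinearMap.ker g)]
    simp
  have := hL.simple l
  have := IsSimpleModule.nontrivial A (L l)
  obtain ⟨y, hy⟩ := exists_ne (0 : L l)
  obtain ⟨x, rfl⟩ := (hp l).surjective y
  exact hy (hz x)

end Filtered

/-! ### Cokernels of maps between modules filtered by standard modules. -/

section Standard

variable {A : Type u} [Ring A] {Λ : Type w} [Preorder Λ] {L P I : Λ → Type u}
    [∀ l, AddCommGroup (L l)] [∀ l, Module A (L l)]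
    [∀ l, AddCommGroup (P l)] [∀ l, Module A (P l)]
    [∀ l, AddCommGroup (I l)] [∀ l, Module A (I l)]
    {p : ∀ l, P l →ₗ[A] L l} {i : ∀ l, L l →ₗ[A] I l}
    {M Y : Type u} [AddCommGroup M] [Module A M] [AddCommGroup Y] [Module A Y]

/-- The homomorphisms from a module filtered by `Δ(k)`, `k ≽ l`, to `∇(l)` are sums of maps that
factor through a quotient `Δ(l)` with filtered kernel. -/
theorem Filtered.hom_properCostandard_mem_closure (hL : IsCompleteSimpleFamily A L)
    (hp : ∀ l, IsProjectiveCover (p l)) (hi : ∀ l, IsInjectiveHull (i l))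
    (hA : IsStandardlyStratified A p) {l : Λ} (hM : Filtered A (Standard A P) {k | l ≤ k} M)
    (g : M →ₗ[A] properCostandard A I l) :
    g ∈ AddSubgroup.closure {g : M →ₗ[A] properCostandard A I l |
      ∃ q : M →ₗ[A] Standard A P l, Function.Surjective q ∧
        Filtered A (Standard A P) Set.univ (LinearMap.ker q) ∧ ∃ h, g = h ∘ₗ q} := by
  induction hM with
  | zero M h =>
    have hg : g = 0 := LinearMap.ext fun x => by rw [Subsingleton.elim x 0, map_zero, map_zero]
    rw [hg]
    exact zero_mem _
  | step M k hk f hf h ih =>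
    -- Each surjection $q\colon\ker f\to\Delta(l)$ extends to $M$ because
    -- $\mathrm{Ext}^1(\Delta(k),\Delta(l))=0$ for $l\preceq k$, so sums of the required form extend
    -- to such sums.
    have key : ∀ g' ∈ AddSubgroup.closure
        {g : LinearMap.ker f →ₗ[A] properCostandard A I l |
          ∃ q : LinearMap.ker f →ₗ[A] Standard A P l, Function.Surjective q ∧
            Filtered A (Standard A P) Set.univ (LinearMap.ker q) ∧ ∃ h, g = h ∘ₗ q},
        ∃ g'' ∈ AddSubgroup.closure {g : M →ₗ[A] properCostandard A I l |
          ∃ q : M →ₗ[A] Standard A P l, Function.Surjective q ∧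
            Filtered A (Standard A P) Set.univ (LinearMap.ker q) ∧ ∃ h, g = h ∘ₗ q},
        ∀ x : LinearMap.ker f, g'' x = g' x := by
      intro g' hg'
      induction hg' using AddSubgroup.closure_induction with
      | mem g' hg' =>
        obtain ⟨q, hq, hqk, t, rfl⟩ := hg'
        obtain ⟨q', hq'⟩ := extZero_standard_standard hL hp hA (fun h => (hk.trans_lt h).false)
          M f hf q
        refine ⟨t ∘ₗ q', AddSubgroup.subset_closure ⟨q', fun z => ?_, ?_, t, rfl⟩, fun x => ?_⟩
        · obtain ⟨x, rfl⟩ := hq z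
          exact ⟨x, hq' x⟩
        · exact .ker_of_extends f hf q' q hq hq' (.of_mem trivial) hqk
        · rw [LinearMap.comp_apply, hq', LinearMap.comp_apply]
      | zero => exact ⟨0, zero_mem _, fun x => rfl⟩
      | add a b _ _ ha hb =>
        obtain ⟨a', ha', ha⟩ := ha
        obtain ⟨b', hb', hb⟩ := hb
        exact ⟨a' + b', add_mem ha' hb', fun x => by simp [ha, hb]⟩
      | neg a _ ha =>
        obtain ⟨a', ha', ha⟩ := ha
        exact ⟨-a', neg_mem ha', fun x => by simp [ha]⟩
    obtain ⟨g', hg', hgg'⟩ := key _ (ih (g ∘ₗ (LinearMap.ker f).subtype))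
    obtain ⟨t, ht⟩ := exists_factor f hf (g - g') fun x hx => by
      rw [LinearMap.sub_apply, hgg' ⟨x, hx⟩]
      exact sub_self _
    rw [← sub_add_cancel g g']
    refine add_mem ?_ hg'
    -- The remainder $g-g'$ factors through $\Delta(k)$. Indices equivalent but not equal to $l$
    -- fall under the second case.
    by_cases hkl : k = l
    · subst hkl
      exact AddSubgroup.subset_closure ⟨f, hf, h.mono (Set.subset_univ _), t,
        LinearMap.ext fun x => (ht x).symm⟩
    · have hgg : g - g' = 0 := LinearMap.ext fun x => by
        rw [← ht, hom_standard_properCostandard_eq_zero hL hp hi hA hkl t]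
        rfl
      rw [hgg]
      exact zero_mem _

/-- If a map from `Δ(l)` to a module filtered by standard modules is not killed by all maps to
`∇(l)`, then it is injective and its cokernel is filtered by standard modules. -/
theorem Filtered.cokernel_of_standard [IsNoetherianRing A] (hL : IsCompleteSimpleFamily A L)
    (hp : ∀ l, IsProjectiveCover (p l)) (hi : ∀ l, IsInjectiveHull (i l))
    (hA : IsStandardlyStratified A p) {l : Λ} (hY : Filtered A (Standard A P) Set.univ Y)
    (φ : Standard A P l →ₗ[A] Y) (g : Y →ₗ[A] properCostandard A I l) (hg : g ∘ₗ φ ≠ 0) :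
    Function.Injective φ ∧
      Filtered A (Standard A P) Set.univ (Y ⧸ LinearMap.range φ) := by
  -- Collect the factors $\Delta(k)$ with $k\succeq l$ in $B$; no nonzero map goes from $\Delta(l)$
  -- to the other factors, so $\varphi$ lands in $B$.
  obtain ⟨B, hB, hYB⟩ := hY.exists_submodule (S := {k | l ≤ k}) fun k hk m hm =>
    extZero_standard_standard hL hp hA fun h => hm (hk.trans h.le)
  have h0 : B.mkQ ∘ₗ φ = 0 := hYB.hom_to_eq_zero
    (fun m hm => hom_standard_standard_eq_zero hL hp hA hm) _
  have hφB : ∀ x, φ x ∈ B := fun x =>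
    (Submodule.Quotient.mk_eq_zero B).mp (LinearMap.congr_fun h0 x)
  set φ' := φ.codRestrict B hφB with hφ'
  have hB' := hB.hom_properCostandard_mem_closure hL hp hi hA (g ∘ₗ B.subtype)
  -- Since $g|_B$ is a sum of maps $\pm h\circ q$, some $h\circ q\circ\varphi'$ is nonzero, which
  -- makes the endomorphism $q\circ\varphi'$ bijective.
  obtain ⟨q, hqk, hq⟩ : ∃ q : B →ₗ[A] Standard A P l,
      Filtered A (Standard A P) Set.univ (LinearMap.ker q) ∧ Function.Bijective (q ∘ₗ φ') := by
    by_contra! hcon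
    suffices (g ∘ₗ B.subtype) ∘ₗ φ' = 0 from hg this
    generalize g ∘ₗ B.subtype = g' at hB'
    induction hB' using AddSubgroup.closure_induction with
    | mem t ht =>
      obtain ⟨q, -, hqk, h, rfl⟩ := ht
      by_contra hne
      exact hcon q hqk (bijective_of_hom_properCostandard hL hp hi (q ∘ₗ φ') h hne)
    | zero => simp
    | add a b _ _ ha hb => rw [LinearMap.add_comp, ha, hb, add_zero]
    | neg a _ ha => rw [LinearMap.neg_comp, ha, neg_zero]
  refine ⟨fun x y hxy => hq.1 ?_, ?_⟩
  · exact congrArg q (Subtype.ext hxy : φ' x = φ' y)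
  have hle : LinearMap.range φ ≤ LinearMap.ker B.mkQ := by
    rintro _ ⟨y, rfl⟩
    exact LinearMap.congr_fun h0 y
  -- Now $B=\mathrm{im}\,\varphi\oplus\ker q$, giving $0\to\ker q\to Y/\mathrm{im}\,\varphi\to
  -- Y/B\to0$.
  refine .of_exact ((LinearMap.range φ).mkQ ∘ₗ B.subtype ∘ₗ (LinearMap.ker q).subtype) ?_
    ((LinearMap.range φ).liftQ B.mkQ hle) ?_ ?_ hqk (hYB.mono (Set.subset_univ _))
  · rw [← LinearMap.ker_eq_bot, LinearMap.ker_eq_bot']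
    rintro ⟨x, hx⟩ hx0
    obtain ⟨y, hy⟩ := (Submodule.Quotient.mk_eq_zero _).mp hx0
    have hyx : φ' y = x := Subtype.ext hy
    have hy0 : y = 0 := hq.1 (by rw [LinearMap.comp_apply, hyx, map_zero]; exact hx)
    rw [hy0, map_zero] at hyx
    exact Subtype.ext hyx.symm
  · exact fun z => (Submodule.mkQ_surjective _ z).imp' (Submodule.mkQ _) fun x hx => hx
  · intro z
    obtain ⟨y, rfl⟩ := Submodule.mkQ_surjective _ z
    constructor
    · intro hy
      have hyB : y ∈ B := (Submodule.Quotient.mk_eq_zero B).mp hy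
      obtain ⟨x, hx⟩ := hq.2 (q ⟨y, hyB⟩)
      refine ⟨⟨⟨y, hyB⟩ - φ' x, ?_⟩, ?_⟩
      · rw [LinearMap.mem_ker, map_sub, sub_eq_zero]
        exact hx.symm
      · rw [← sub_eq_zero, LinearMap.comp_apply, ← map_sub, Submodule.mkQ_apply,
          Submodule.Quotient.mk_eq_zero]
        exact ⟨-x, by simp [hφ']⟩
    · rintro ⟨x, hx⟩
      rw [← hx]
      exact (Submodule.Quotient.mk_eq_zero B).mpr x.1.2

/-- A map between modules filtered by standard modules such that all maps to proper costandard
modules extend along it is injective and its cokernel is filtered by standard modules. -/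
theorem Filtered.cokernel [IsNoetherianRing A] (hL : IsCompleteSimpleFamily A L)
    (hp : ∀ l, IsProjectiveCover (p l)) (hi : ∀ l, IsInjectiveHull (i l))
    (hA : IsStandardlyStratified A p) (hM : Filtered A (Standard A P) Set.univ M)
    (hY : Filtered A (Standard A P) Set.univ Y) (φ : M →ₗ[A] Y)
    (hφ : ∀ l, ∀ h : M →ₗ[A] properCostandard A I l, ∃ k : Y →ₗ[A] properCostandard A I l,
      ∀ x, k (φ x) = h x) :
    Function.Injective φ ∧
      Filtered A (Standard A P) Set.univ (Y ⧸ LinearMap.range φ) := by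
  induction hM with
  | zero M h =>
    refine ⟨Function.injective_of_subsingleton _, hY.of_equiv
      (Submodule.quotEquivOfEqBot _ ?_).symm⟩
    rw [LinearMap.range_eq_bot]
    exact LinearMap.ext fun x => by rw [Subsingleton.elim x 0, map_zero, map_zero]
  | step M l hl f hf h ih =>
    -- The extension hypothesis passes to $\ker f$: maps to $\overline\nabla(m)$ extend from $\ker
    -- f$ to $M$ by $\mathrm{Ext}^1(\Delta(l),\overline\nabla(m))=0$.
    obtain ⟨hinj, hY'⟩ := ih (φ ∘ₗ (LinearMap.ker f).subtype) fun m t => by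
      obtain ⟨t', ht'⟩ := extZero_standard_properCostandard hL hp hi hA l m M f hf t
      obtain ⟨k, hk⟩ := hφ m t'
      exact ⟨k, fun x => (hk x).trans (ht' x)⟩
    set R := LinearMap.range (φ ∘ₗ (LinearMap.ker f).subtype) with hR
    obtain ⟨ψ, hψ⟩ := exists_factor f hf (R.mkQ ∘ₗ φ) fun x hx =>
      (Submodule.Quotient.mk_eq_zero R).mpr ⟨⟨x, hx⟩, rfl⟩
    obtain ⟨t, ht⟩ := exists_standard_properCostandard_ne_zero hL hp hi hA l
    -- As $t\circ f$ vanishes on $\ker f$, its extension $k$ descends to $Y/R$, where it witnesses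
    -- that $\psi\colon\Delta(l)\to Y/R$ is not killed by all maps to $\overline\nabla(l)$.
    obtain ⟨k, hk⟩ := hφ l (t ∘ₗ f)
    have hkR : R ≤ LinearMap.ker k := by
      rintro _ ⟨x, rfl⟩
      have hx : f x = 0 := x.2
      rw [LinearMap.mem_ker, LinearMap.comp_apply, Submodule.subtype_apply, hk,
        LinearMap.comp_apply, hx, map_zero]
    obtain ⟨hψi, hψY⟩ := hY'.cokernel_of_standard hL hp hi hA ψ (R.liftQ k hkR) fun h0 => by
      refine ht (LinearMap.ext fun y => ?_)
      obtain ⟨x, rfl⟩ := hf y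
      have := LinearMap.congr_fun h0 (f x)
      rw [LinearMap.comp_apply, hψ] at this
      exact (hk x).symm.trans this
    constructor
    · rw [← LinearMap.ker_eq_bot, LinearMap.ker_eq_bot']
      intro x hx
      have hfx : f x = 0 := hψi (by rw [hψ, LinearMap.comp_apply, hx, map_zero, map_zero])
      have : (⟨x, hfx⟩ : LinearMap.ker f) = 0 := hinj (hx.trans (map_zero _).symm)
      exact congrArg Subtype.val this
    · have hker : LinearMap.ker ((LinearMap.range ψ).mkQ ∘ₗ R.mkQ) = LinearMap.range φ := by
        ext y
        rw [LinearMap.mem_ker, LinearMap.comp_apply, Submodule.mkQ_apply,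
          Submodule.Quotient.mk_eq_zero]
        constructor
        · rintro ⟨z, hz⟩
          obtain ⟨x, rfl⟩ := hf z
          rw [hψ, LinearMap.comp_apply, ← sub_eq_zero, ← map_sub, Submodule.mkQ_apply,
            Submodule.Quotient.mk_eq_zero] at hz
          obtain ⟨w, hw⟩ := hz
          exact ⟨x - w, by rw [map_sub, sub_eq_iff_eq_add, ← sub_eq_iff_eq_add']; exact hw.symm⟩
        · rintro ⟨x, rfl⟩
          exact ⟨f x, hψ x⟩
      exact hψY.of_equiv ((((LinearMap.range ψ).mkQ ∘ₗ R.mkQ).quotKerEquivOfSurjective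
        ((Submodule.mkQ_surjective _).comp (Submodule.mkQ_surjective _))).symm ≪≫ₗ
          Submodule.quotEquivOfEq _ _ hker)

end Standard

/-! ### From a cogenerated cokernel to the double centraliser property. -/

section DoubleCentraliser

/-- A finitely generated module over a finite-dimensional algebra is finitely generated over its
endomorphism ring. -/
theorem exists_generators_over_end (K : Type v) [Field K] (A : Type u) [Ring A] [Algebra K A]
    [FiniteDimensional K A] (T : Type w) [AddCommGroup T] [Module A T] [Module.Finite A T] :
    ∃ (n : ℕ) (t : Fin n → T), ∀ x : T, ∃ e : Fin n → Module.End A T, x = ∑ j, e j (t j) := by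
  let _ : Module K T := Module.compHom T (algebraMap K A)
  have : IsScalarTower K A T := ⟨fun c a x => by
    rw [Algebra.smul_def, mul_smul]
    rfl⟩
  have : Module.Finite K T := .trans A T
  obtain ⟨n, t, ht⟩ := Module.Finite.exists_fin (R := K) (M := T)
  refine ⟨n, t, fun x => ?_⟩
  obtain ⟨c, hc⟩ := (Submodule.mem_span_range_iff_exists_fun K).mp
    (ht ▸ Submodule.mem_top : x ∈ Submodule.span K (Set.range t))
  -- Scalars of $K$ act centrally, so a $K$-basis expansion is already an expansion over
  -- $\mathrm{End}_A(T)$; only a spanning family is needed.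
  let e (c : K) : Module.End A T :=
    { toFun := fun x => algebraMap K A c • x
      map_add' := smul_add _
      map_smul' := fun a x => by
        rw [← mul_smul, Algebra.commutes, mul_smul]
        rfl }
  exact ⟨fun j => e (c j), hc.symm⟩

/-- If the `t j` generate `T` over its endomorphism ring and the cokernel of `A → Tⁿ`,
`a ↦ (a t j)`, is cogenerated by `T`, then `A` has the double centraliser property with respect
to `T`. -/
theorem hasDoubleCentraliser_of_cokernel {A : Type u} [Ring A] {T : Type w} [AddCommGroup T]
    [Module A T] {n : ℕ} (t : Fin n → T)
    (ht : ∀ x : T, ∃ e : Fin n → Module.End A T, x = ∑ j, e j (t j))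
    (hC : ∀ y : (Fin n → T) ⧸ LinearMap.range (LinearMap.toSpanSingleton A (Fin n → T) t), y ≠ 0 →
      ∃ f : ((Fin n → T) ⧸ LinearMap.range (LinearMap.toSpanSingleton A (Fin n → T) t)) →ₗ[A] T,
        f y ≠ 0) :
    HasDoubleCentraliser A T := by
  intro α
  have hα : ∀ (e : Fin n → Module.End A T) (s : Fin n → T),
      α (∑ j, e j (s j)) = ∑ j, e j (α (s j)) := fun e s => by
    rw [map_sum]
    exact Finset.sum_congr rfl fun j _ => α.map_smul (e j) (s j)
  obtain ⟨a, ha⟩ : (fun j => α (t j)) ∈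
      LinearMap.range (LinearMap.toSpanSingleton A (Fin n → T) t) := by
    by_contra hcon
    rw [← Submodule.Quotient.mk_eq_zero] at hcon
    obtain ⟨f, hf⟩ := hC _ hcon
    set f' := f ∘ₗ (LinearMap.range (LinearMap.toSpanSingleton A (Fin n → T) t)).mkQ with hf'
    -- The components of $f'\colon T^n\to T$ are endomorphisms of $T$, hence commute with $\alpha$:
    -- $f'((\alpha(t_j))_j)=\alpha(f'(t))=0$.
    have hsum : ∀ s : Fin n → T, f' s = ∑ j, (f' ∘ₗ LinearMap.single A (fun _ => T) j) (s j) :=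
      fun s => by
        simp only [LinearMap.comp_apply, ← map_sum]
        congr 1
        exact (Finset.univ_sum_single s).symm
    have ht1 : t ∈ LinearMap.range (LinearMap.toSpanSingleton A (Fin n → T) t) := ⟨1, by simp⟩
    have h0 : f' t = 0 := by
      rw [hf', LinearMap.comp_apply, Submodule.mkQ_apply,
        (Submodule.Quotient.mk_eq_zero _).mpr ht1, map_zero]
    refine hf ((hsum _).trans ?_)
    rw [← hα, ← hsum, h0, map_zero]
  refine ⟨a, LinearMap.ext fun x => ?_⟩
  obtain ⟨e, rfl⟩ := ht x
  rw [hα]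
  change a • ∑ j, e j (t j) = _
  rw [Finset.smul_sum]
  exact Finset.sum_congr rfl fun j _ =>
    ((e j).map_smul a (t j)).symm.trans (congrArg (e j) (congrFun ha j))

end DoubleCentraliser

end StdStrat
theorem mainTheorem1 {K : Type v} [Field K] {A : Type u} [Ring A] [Algebra K A]
    [FiniteDimensional K A]
    -- the index set of the simple modules, with the preorder of the stratification
    {Λ : Type w} [Preorder Λ]
    -- the simple modules, their projective covers and their injective hulls
    (L P I : Λ → Type u)
    [∀ l, AddCommGroup (L l)] [∀ l, Module A (L l)]
    [∀ l, AddCommGroup (P l)] [∀ l, Module A (P l)]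
    [∀ l, AddCommGroup (I l)] [∀ l, Module A (I l)]
    (hL : StdStrat.IsCompleteSimpleFamily A L)
    (hsplit : StdStrat.IsSplitOver K A L)
    (p : ∀ l, P l →ₗ[A] L l) (hp : ∀ l, StdStrat.IsProjectiveCover (p l))
    (i : ∀ l, L l →ₗ[A] I l) (hi : ∀ l, StdStrat.IsInjectiveHull (i l))
    (hA : StdStrat.IsStandardlyStratified A p)
    (T : Type u) [AddCommGroup T] [Module A T] (hT : StdStrat.IsTilting A P I T)
    (r : ℕ)
    (hΔ : ∀ l, ∃ f : StdStrat.Standard A P l →ₗ[A] (Fin r → T), Function.Injective f)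
    (hnabla : ∀ l, ∃ g : (Fin r → T) →ₗ[A] StdStrat.properCostandard A I l,
      Function.Surjective g) :
    FaithfulSMul A T ∧ StdStrat.HasDoubleCentraliser A T ∧
      Function.Bijective (StdStrat.canonicalMap A T) := by

  have hAr : IsArtinianRing A := IsArtinianRing.of_finite K A
  have hTf := hT.finite
  obtain ⟨n, t, ht⟩ := StdStrat.exists_generators_over_end K A T
  have hTΔ := StdStrat.filtered_of_hasFiltration hT.standard_filtration
  have hTe : ∀ l, StdStrat.ExtZero A (StdStrat.Standard A P l) T := fun l =>
    (StdStrat.filtered_of_hasFiltration hT.properCostandard_filtration).extZero fun m _ =>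
      StdStrat.extZero_standard_properCostandard hL hp hi hA l m
  have hAΔ : StdStrat.Filtered A (StdStrat.Standard A P) Set.univ A :=
    StdStrat.filtered_of_projective hL hp hA.filtered_projective
  obtain ⟨hinj, hcok⟩ := hAΔ.cokernel hL hp hi hA (hTΔ.pi_fin n)
    (LinearMap.toSpanSingleton A (Fin n → T) t) fun l h => by
      obtain ⟨g, hg⟩ := hnabla l
      obtain ⟨y, hy⟩ := hg (h 1)
      choose e he using fun j => ht (y j)
      -- The matrix $(e_{jk})$ sends $t$ to a preimage $y\in T^r$ of $h(1)$; a map from $A$ is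
      -- determined by its value at $1$.
      refine ⟨g ∘ₗ LinearMap.pi fun j => ∑ k, e j k ∘ₗ LinearMap.proj k, fun a => ?_⟩
      have hy' : (LinearMap.pi fun j => ∑ k, e j k ∘ₗ LinearMap.proj k) t = y := by
        ext j
        simp [he j]
      rw [LinearMap.toSpanSingleton_apply, map_smul, LinearMap.comp_apply, hy', hy, ← map_smul,
        smul_eq_mul, mul_one]
  have hfaith : FaithfulSMul A T := ⟨fun {a b} hab => hinj (funext fun j => hab (t j))⟩
  have hdc : StdStrat.HasDoubleCentraliser A T := by
    refine StdStrat.hasDoubleCentraliser_of_cokernel t ht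
      (hcok.exists_hom_ne_zero (fun l _ => hTe l) fun l _ x hx => ?_)
    obtain ⟨f, hf⟩ := hΔ l
    obtain ⟨j, hj⟩ := Function.ne_iff.mp ((map_ne_zero_iff f hf).mpr hx)
    exact ⟨LinearMap.proj j ∘ₗ f, hj⟩
  exact ⟨hfaith, hdc, fun a b hab => hfaith.eq_of_smul_eq_smul (LinearMap.congr_fun hab), hdc⟩
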